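/- Let $\mathcal A$ be a nonempty compact set of real $2\times 2$ Metzler matrices (matrices with nonnegative off-diagonal entries). A trajectory of the linear switching system $\mathcal A$ is an absolutely continuous solution $\boldsymbol x:[0,\infty)\to\mathbb R^2$ of $\dot{\boldsymbol x}(t)=A(t)\boldsymbol x(t)$ for some measurable switching law $A(\cdot):[0,\infty)\to\mathcal A$. The Lyapunov exponent $\sigma=\sigma(\mathcal A)$ is the infimum of the numbers $s\in\mathbb R$ such that for every trajectory $\boldsymbol x$ there is a constant $C=C(\boldsymbol x)$ with $\|\boldsymbol x(t)\|\le Ce^{st}$ for all $t\ge 0$. (1) If $\sigma I\notin\mathcal A$, then $\mathcal A$ has real dominance: there is a matrix $A\in\mathrm{co}(\mathcal A)$, $A\neq\sigma I$, whose eigenvalues are all real and whose largest eigenvalue equals $\sigma$. (2) If for every $A\in\mathrm{co}(\mathcal A)$ and every $\boldsymbol x_0\in\mathbb R^2$ the stationary trajectory $e^{tA}\boldsymbol x_0$ tends to zero as $t\to+\infty$, then the system is stable, that is, every trajectory of $\mathcal A$ tends to zero as $t\to+\infty$. -/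

import Mathlib

open Set Filter Topology MeasureTheory

noncomputable section

/-- A measurable switching law `L` on `[0, ∞)` with values in the control set `𝒜`
(the values of `L` at negative times are irrelevant). -/
structure IsSwitchingLaw {d : ℕ} (𝒜 : Set (Matrix (Fin d) (Fin d) ℝ))
    (L : ℝ → Matrix (Fin d) (Fin d) ℝ) : Prop where
  measurable : ∀ i j, Measurable fun t => L t i j
  mem : ∀ t, 0 ≤ t → L t ∈ 𝒜

/-- `x` is an absolutely continuous (Carathéodory) solution of `x' = L(t) x` on `[0, ∞)`:
the integrand is integrable on every `[0, t]` and the integral form of the equation holds. -/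
structure SolvesODE {d : ℕ} (L : ℝ → Matrix (Fin d) (Fin d) ℝ) (x : ℝ → Fin d → ℝ) : Prop where
  continuousOn : ContinuousOn x (Ici 0)
  integrable : ∀ t, 0 ≤ t → IntervalIntegrable (fun s => (L s).mulVec (x s)) volume 0 t
  eq : ∀ t, 0 ≤ t → x t = x 0 + ∫ s in (0 : ℝ)..t, (L s).mulVec (x s)

/-- A trajectory of the linear switching system with control set `𝒜`. -/
def IsTrajectory {d : ℕ} (𝒜 : Set (Matrix (Fin d) (Fin d) ℝ)) (x : ℝ → Fin d → ℝ) : Prop :=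
  ∃ L, IsSwitchingLaw 𝒜 L ∧ SolvesODE L x

/-- A stationary trajectory: one generated by a constant switching law `A(t) ≡ A`, where `A`
is a matrix of the convex hull of the control set; thus `x t = exp (t A) x₀` for `t ≥ 0`. -/
def IsStationaryTrajectory {d : ℕ} (𝒜 : Set (Matrix (Fin d) (Fin d) ℝ))
    (x : ℝ → Fin d → ℝ) : Prop :=
  ∃ A ∈ convexHull ℝ 𝒜, IsTrajectory {A} x

/-- Asymptotic stability: all trajectories tend to zero. -/
def IsStableSystem {d : ℕ} (𝒜 : Set (Matrix (Fin d) (Fin d) ℝ)) : Prop :=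
  ∀ x, IsTrajectory 𝒜 x → Tendsto x atTop (𝓝 0)

/-- The Lyapunov exponent: the infimum of the numbers `σ` such that each trajectory `x` satisfies
`‖x t‖ ≤ C exp (σ t)`, `t ≥ 0`, with a constant `C` that may depend on `x`.
The choice of the norm is immaterial. For a nonempty compact `𝒜` and `d ≥ 1` the set of such
numbers is nonempty and bounded below, so that the infimum is a genuine one. -/
def lyapunovExponent {d : ℕ} (𝒜 : Set (Matrix (Fin d) (Fin d) ℝ)) : ℝ :=
  sInf {σ : ℝ | ∀ x, IsTrajectory 𝒜 x →
    ∃ C : ℝ, ∀ t, 0 ≤ t → ‖x t‖ ≤ C * Real.exp (σ * t)}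

/-- The complex eigenvalues of a real square matrix. -/
def complexEigenvalues {d : ℕ} (A : Matrix (Fin d) (Fin d) ℝ) : Set ℂ :=
  spectrum ℂ (A.map Complex.ofReal)

/-- A dominant matrix: a matrix of the convex hull of `𝒜`, different from `σ I`, whose eigenvalues
have largest real part `σ`, where `σ` is the Lyapunov exponent of `𝒜`. -/
structure IsDominant {d : ℕ} (𝒜 : Set (Matrix (Fin d) (Fin d) ℝ))
    (A : Matrix (Fin d) (Fin d) ℝ) : Prop where
  mem_convexHull : A ∈ convexHull ℝ 𝒜
  ne_scalar : A ≠ lyapunovExponent 𝒜 • (1 : Matrix (Fin d) (Fin d) ℝ)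
  isGreatest : IsGreatest (Complex.re '' complexEigenvalues A) (lyapunovExponent 𝒜)

/-- Real dominance of a planar system: there is a dominant matrix with real eigenvalues. -/
def HasRealDominance (𝒜 : Set (Matrix (Fin 2) (Fin 2) ℝ)) : Prop :=
  ∃ A, IsDominant 𝒜 A ∧ ∀ μ ∈ complexEigenvalues A, μ.im = 0

/-- Metzler matrices: the off-diagonal entries are nonnegative. -/
def IsMetzler {d : ℕ} (A : Matrix (Fin d) (Fin d) ℝ) : Prop :=
  ∀ i j, i ≠ j → 0 ≤ A i j

/-- A positive system: the control set consists of Metzler matrices. -/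
def IsPositiveSystem {d : ℕ} (𝒜 : Set (Matrix (Fin d) (Fin d) ℝ)) : Prop :=
  ∀ A ∈ 𝒜, IsMetzler A

end

/-! Everything rests on one identity: σ is the maximum of the Perron roots over the convex hull,
attained by compactness (`IsPositiveSystem.lyapunovExponent_eq`). Hull matrices are Metzler, so
their eigenvalues are real and a maximiser is dominant unless it equals σI; but σI can lie in the
hull only by lying in 𝒜 (`IsPositiveSystem.smul_one_mem`). If stationary trajectories decay, the
maximum is negative and every trajectory decays exponentially.

Lower bound (`IsPositiveSystem.perronRoot_le`): let w ≥ 0 be a left Perron vector of a hull matrix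
with root l. For x ≥ 0 the linear function B ↦ w·Bx takes a value at least l(w·x) somewhere on 𝒜, so
sampled feedback produces a trajectory along which w·x grows at a rate as close to l as desired.

Upper bound (`SolvesODE.exists_exp_bound`): let all Perron roots be below s. By Collatz–Wielandt no
velocity at a nonzero v ≥ 0 is radial with rate ≥ s. Separating the velocities from these radial
ones gives a slope at every direction, and the slopes can be chosen continuously. Directions of the
quadrant form a segment, so any continuous slope field integrates to a homogeneous function V with
derivative below sV; this is where the dimension two enters. Trajectories may leave the quadrant, so
V is evaluated at |x|, which follows a system with off-diagonal entries in [-A i j, A i j]; such B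
still satisfy Bv ≤ Av for v ≥ 0. -/

noncomputable section

/-! ### Perron roots of planar Metzler matrices -/

/-- The larger eigenvalue of a real `2 × 2` Metzler matrix. -/
def perronRoot (A : Matrix (Fin 2) (Fin 2) ℝ) : ℝ :=
  (A 0 0 + A 1 1 + √((A 0 0 - A 1 1) ^ 2 + 4 * (A 0 1 * A 1 0))) / 2

theorem continuous_perronRoot : Continuous perronRoot := by
  unfold perronRoot
  fun_prop

theorem IsMetzler.mul_offDiag_nonneg {A : Matrix (Fin 2) (Fin 2) ℝ} (hA : IsMetzler A) :
    0 ≤ A 0 1 * A 1 0 :=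
  mul_nonneg (hA 0 1 (by decide)) (hA 1 0 (by decide))

theorem IsMetzler.perronRoot_eq {A : Matrix (Fin 2) (Fin 2) ℝ} (hA : IsMetzler A) :
    (perronRoot A - A 0 0) * (perronRoot A - A 1 1) = A 0 1 * A 1 0 := by
  have h := hA.mul_offDiag_nonneg
  have hs := Real.sq_sqrt (show 0 ≤ (A 0 0 - A 1 1) ^ 2 + 4 * (A 0 1 * A 1 0) by positivity)
  unfold perronRoot
  linear_combination hs / 4

theorem IsMetzler.diag_le_perronRoot {A : Matrix (Fin 2) (Fin 2) ℝ} (hA : IsMetzler A)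
    (i : Fin 2) : A i i ≤ perronRoot A := by
  have h := hA.mul_offDiag_nonneg
  have hs : |A 0 0 - A 1 1| ≤ √((A 0 0 - A 1 1) ^ 2 + 4 * (A 0 1 * A 1 0)) :=
    Real.abs_le_sqrt (by linarith)
  have := abs_le.1 hs
  unfold perronRoot
  fin_cases i <;> simp <;> linarith

/-- The Collatz–Wielandt bound. -/
theorem IsMetzler.le_perronRoot {A : Matrix (Fin 2) (Fin 2) ℝ} (hA : IsMetzler A)
    {v : Fin 2 → ℝ} (hv : 0 ≤ v) (hv0 : v ≠ 0) {s : ℝ} (h : s • v ≤ A.mulVec v) :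
    s ≤ perronRoot A := by
  by_contra! hlt
  have h0 := hA.diag_le_perronRoot 0
  have h1 := hA.diag_le_perronRoot 1
  have hb := hA 0 1 (by decide)
  have hc := hA 1 0 (by decide)
  have he := hA.perronRoot_eq
  have hv1 := hv 0
  have hv2 := hv 1
  have e0 := h 0
  have e1 := h 1
  simp only [Matrix.mulVec, dotProduct, Fin.sum_univ_two, Pi.smul_apply, smul_eq_mul,
    Pi.zero_apply] at e0 e1 hv1 hv2
  -- Above the Perron root det(sI - A) is positive, while eliminating a coordinate from `k0` and
  -- `k1` gives det(sI - A) * v i ≤ 0.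
  have hprod : A 0 1 * A 1 0 < (s - A 0 0) * (s - A 1 1) := by nlinarith
  have k0 : (s - A 0 0) * v 0 ≤ A 0 1 * v 1 := by linarith
  have k1 : (s - A 1 1) * v 1 ≤ A 1 0 * v 0 := by linarith
  have p0 : 0 < s - A 0 0 := by linarith
  have p1 : 0 < s - A 1 1 := by linarith
  have m0 : ((s - A 0 0) * (s - A 1 1) - A 0 1 * A 1 0) * v 0 ≤ 0 := by nlinarith
  have m1 : ((s - A 0 0) * (s - A 1 1) - A 0 1 * A 1 0) * v 1 ≤ 0 := by nlinarith
  apply hv0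
  ext i
  fin_cases i
  · show v 0 = 0
    nlinarith
  · show v 1 = 0
    nlinarith

/-- With l the Perron root, both columns of the adjugate of lI - A are nonnegative and killed by lI
- A; they vanish together only if A = lI, when any vector serves. -/
theorem IsMetzler.exists_eigenvector {A : Matrix (Fin 2) (Fin 2) ℝ} (hA : IsMetzler A) :
    ∃ v : Fin 2 → ℝ, 0 ≤ v ∧ v ≠ 0 ∧ A.mulVec v = perronRoot A • v := by
  have h0 := hA.diag_le_perronRoot 0
  have h1 := hA.diag_le_perronRoot 1
  have hb := hA 0 1 (by decide)
  have hc := hA 1 0 (by decide)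
  have he := hA.perronRoot_eq
  set l := perronRoot A
  by_cases hu : (![A 0 1, l - A 0 0] : Fin 2 → ℝ) = 0
  · by_cases hw : (![l - A 1 1, A 1 0] : Fin 2 → ℝ) = 0
    · have a1 := congrFun hu 0
      have a2 := congrFun hu 1
      have a3 := congrFun hw 0
      have a4 := congrFun hw 1
      simp at a1 a2 a3 a4
      refine ⟨![1, 0], ?_, ?_, ?_⟩
      · intro i; fin_cases i <;> simp
      · intro h; simpa using congrFun h 0
      · ext i
        fin_cases i <;> simp [Matrix.mulVec, dotProduct, Fin.sum_univ_two] <;> linarith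
    · refine ⟨_, ?_, hw, ?_⟩
      · intro i; fin_cases i <;> simp <;> linarith
      · ext i
        fin_cases i <;> simp [Matrix.mulVec, dotProduct, Fin.sum_univ_two] <;> linarith
  · refine ⟨_, ?_, hu, ?_⟩
    · intro i; fin_cases i <;> simp <;> linarith
    · ext i
      fin_cases i <;> simp [Matrix.mulVec, dotProduct, Fin.sum_univ_two] <;> linarith

theorem IsMetzler.transpose {d : ℕ} {A : Matrix (Fin d) (Fin d) ℝ} (hA : IsMetzler A) :
    IsMetzler A.transpose := fun i j hij => hA j i hij.symm

theorem perronRoot_transpose (A : Matrix (Fin 2) (Fin 2) ℝ) :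
    perronRoot A.transpose = perronRoot A := by
  simp [perronRoot, mul_comm]

theorem mem_complexEigenvalues_iff (A : Matrix (Fin 2) (Fin 2) ℝ) (z : ℂ) :
    z ∈ complexEigenvalues A ↔ (z - A 0 0) * (z - A 1 1) = A 0 1 * A 1 0 := by
  unfold complexEigenvalues
  rw [spectrum.mem_iff, Matrix.isUnit_iff_isUnit_det, isUnit_iff_ne_zero, not_not,
    Matrix.det_fin_two]
  simp [Matrix.algebraMap_matrix_apply, sub_eq_zero]

theorem IsMetzler.mem_complexEigenvalues_iff {A : Matrix (Fin 2) (Fin 2) ℝ} (hA : IsMetzler A)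
    (z : ℂ) : z ∈ complexEigenvalues A ↔
      z = perronRoot A ∨ z = ((A 0 0 + A 1 1 - perronRoot A : ℝ) : ℂ) := by
  have he : (((perronRoot A - A 0 0) * (perronRoot A - A 1 1) : ℝ) : ℂ)
      = ((A 0 1 * A 1 0 : ℝ) : ℂ) := by rw [hA.perronRoot_eq]
  push_cast at he
  rw [_root_.mem_complexEigenvalues_iff, ← he, ← sub_eq_zero,
    ← sub_eq_zero (a := z) (b := (perronRoot A : ℂ)),
    ← sub_eq_zero (a := z) (b := ((A 0 0 + A 1 1 - perronRoot A : ℝ) : ℂ)), ← mul_eq_zero]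
  push_cast
  constructor <;> intro h <;> linear_combination h

theorem IsMetzler.isGreatest_perronRoot {A : Matrix (Fin 2) (Fin 2) ℝ} (hA : IsMetzler A) :
    IsGreatest (Complex.re '' complexEigenvalues A) (perronRoot A) := by
  refine ⟨⟨perronRoot A, (hA.mem_complexEigenvalues_iff _).2 (Or.inl rfl), by simp⟩, ?_⟩
  rintro _ ⟨z, hz, rfl⟩
  have h0 := hA.diag_le_perronRoot 0
  have h1 := hA.diag_le_perronRoot 1
  rcases (hA.mem_complexEigenvalues_iff _).1 hz with rfl | rfl
  · simp
  · rw [Complex.ofReal_re]; linarith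

theorem IsMetzler.complexEigenvalues_im {A : Matrix (Fin 2) (Fin 2) ℝ} (hA : IsMetzler A)
    {z : ℂ} (hz : z ∈ complexEigenvalues A) : z.im = 0 := by
  rcases (hA.mem_complexEigenvalues_iff _).1 hz with rfl | rfl <;> exact Complex.ofReal_im _

/-! ### The convex hull of the control set -/

theorem convex_setOf_isMetzler {d : ℕ} :
    Convex ℝ {A : Matrix (Fin d) (Fin d) ℝ | IsMetzler A} := by
  intro A hA B hB a b ha hb _ i j hij
  have h1 := mul_nonneg ha (hA i j hij)
  have h2 := mul_nonneg hb (hB i j hij)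
  simpa using add_nonneg h1 h2

theorem IsPositiveSystem.isMetzler_of_mem_convexHull {d : ℕ}
    {𝒜 : Set (Matrix (Fin d) (Fin d) ℝ)} (h : IsPositiveSystem 𝒜)
    {A : Matrix (Fin d) (Fin d) ℝ} (hA : A ∈ convexHull ℝ 𝒜) : IsMetzler A :=
  convexHull_min (fun _ hB => h _ hB) convex_setOf_isMetzler hA

/-- A scalar matrix `s I` of the convex hull of a planar positive system with `s` bounding
the Perron roots from above belongs to the system itself. -/
theorem IsPositiveSystem.smul_one_mem {𝒜 : Set (Matrix (Fin 2) (Fin 2) ℝ)}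
    (hpos : IsPositiveSystem 𝒜) {s : ℝ} (hs : ∀ A ∈ 𝒜, perronRoot A ≤ s)
    (h : s • (1 : Matrix (Fin 2) (Fin 2) ℝ) ∈ convexHull ℝ 𝒜) :
    s • (1 : Matrix (Fin 2) (Fin 2) ℝ) ∈ 𝒜 := by
  by_contra hn
  -- On 𝒜 the diagonal entries are at most s and the off-diagonal ones nonnegative, so this linear
  -- function is at most 2s, with equality only at sI.
  let C : Set (Matrix (Fin 2) (Fin 2) ℝ) := {A | A 0 0 + A 1 1 - A 0 1 - A 1 0 < 2 * s}
  have hC : Convex ℝ C := by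
    intro A hA B hB a b ha hb hab
    simp only [C, mem_ofPred_eq, Matrix.add_apply, Matrix.smul_apply, smul_eq_mul] at *
    obtain rfl : b = 1 - a := by linarith
    rcases ha.eq_or_lt with rfl | ha
    · nlinarith
    · nlinarith
  have hsub : 𝒜 ⊆ C := by
    intro A hA
    have h0 := (hpos A hA).diag_le_perronRoot 0
    have h1 := (hpos A hA).diag_le_perronRoot 1
    have h01 := hpos A hA 0 1 (by decide)
    have h10 := hpos A hA 1 0 (by decide)
    have hs' := hs A hA
    by_contra hle
    simp only [C, mem_ofPred_eq, not_lt] at hle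
    apply hn
    convert hA
    ext i j
    fin_cases i <;> fin_cases j <;> simp <;> linarith
  have := convexHull_min hsub hC h
  simp [C] at this
  linarith

/-- In a finite-dimensional space the convex hull of a compact set is compact. -/
theorem isCompact_convexHull_of_isCompact {E : Type*} [AddCommGroup E] [Module ℝ E]
    [TopologicalSpace E] [IsTopologicalAddGroup E] [ContinuousSMul ℝ E] [FiniteDimensional ℝ E]
    {s : Set E} (hs : IsCompact s) : IsCompact (convexHull ℝ s) := by
  rcases s.eq_empty_or_nonempty with rfl | ⟨z₀, hz₀⟩
  · simp
  let m := Module.finrank ℝ E + 1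
  have hK : IsCompact (stdSimplex ℝ (Fin m) ×ˢ (Set.pi univ fun _ : Fin m => s)) :=
    (isCompact_stdSimplex ℝ (Fin m)).prod (isCompact_univ_pi fun _ => hs)
  have hc : Continuous fun p : (Fin m → ℝ) × (Fin m → E) => ∑ i, p.1 i • p.2 i := by fun_prop
  convert hK.image hc
  ext x
  constructor
  · intro hx
    obtain ⟨ι, _, z, w, hz, hind, hw, hw1, hx⟩ := eq_pos_convex_span_of_mem_convexHull hx
    have hcard : Fintype.card ι ≤ Fintype.card (Fin m) := by
      rw [Fintype.card_fin]
      exact hind.card_le_finrank_succ.trans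
        (Nat.succ_le_succ (Submodule.finrank_le _))
    obtain ⟨e⟩ := Function.Embedding.nonempty_of_card_le hcard
    -- Carathéodory combinations may have fewer terms; they are padded to the fixed length m with
    -- weight 0 at the point z₀.
    refine ⟨(Function.extend e w 0, Function.extend e z fun _ => z₀), ⟨⟨?_, ?_⟩, ?_⟩, ?_⟩
    · intro j
      by_cases hj : ∃ i, e i = j
      · obtain ⟨i, rfl⟩ := hj
        simpa [e.injective.extend_apply] using (hw i).le
      · simp [Function.extend_apply' _ _ _ hj]
    · rw [← hw1]
      symm
      apply Fintype.sum_of_injective e e.injective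
      · intro j hj
        exact Function.extend_apply' _ _ _ hj
      · intro i
        exact (e.injective.extend_apply _ _ _).symm
    · intro j _
      by_cases hj : ∃ i, e i = j
      · obtain ⟨i, rfl⟩ := hj
        simpa [e.injective.extend_apply] using hz (mem_range_self i)
      · simpa [Function.extend_apply' _ _ _ hj] using hz₀
    · rw [← hx]
      symm
      apply Fintype.sum_of_injective e e.injective
      · intro j hj
        simp [Function.extend_apply' w _ _ hj]
      · intro i
        simp [e.injective.extend_apply]
  · rintro ⟨⟨w, z⟩, ⟨⟨hw, hw1⟩, hz⟩, rfl⟩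
    exact (convex_convexHull ℝ s).sum_mem (fun i _ => hw i) hw1
      fun i _ => subset_convexHull ℝ s (hz i (mem_univ i))

theorem IsCompact.exists_entries_bound {d : ℕ} {𝒞 : Set (Matrix (Fin d) (Fin d) ℝ)}
    (h : IsCompact 𝒞) : ∃ K : ℝ, 0 ≤ K ∧ ∀ B ∈ 𝒞, ∀ i j, |B i j| ≤ K := by
  have : ∀ i j, ∃ c : ℝ, ∀ B ∈ 𝒞, |B i j| ≤ c := fun i j => by
    simpa using h.exists_bound_of_continuousOn (f := fun B => B i j) (by fun_prop)
  choose c hc using this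
  refine ⟨∑ i, ∑ j, |c i j|, by positivity, fun B hB i j => ?_⟩
  calc |B i j| ≤ |c i j| := (hc i j B hB).trans (le_abs_self _)
    _ ≤ ∑ j, |c i j| := Finset.single_le_sum (f := fun j => |c i j|)
        (fun _ _ => abs_nonneg _) (Finset.mem_univ j)
    _ ≤ _ := Finset.single_le_sum (f := fun i => ∑ j, |c i j|)
        (fun _ _ => Finset.sum_nonneg fun _ _ => abs_nonneg _) (Finset.mem_univ i)

/-! ### Piecewise stationary trajectories -/

/-- Concatenation of solution pieces of equal length `δ`. -/
theorem solvesODE_concat {d : ℕ} {B : ℕ → Matrix (Fin d) (Fin d) ℝ} {y : ℕ → ℝ → Fin d → ℝ}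
    {δ : ℝ} (hδ : 0 < δ) (hy : ∀ n τ, HasDerivAt (y n) ((B n).mulVec (y n τ)) τ)
    (hglue : ∀ n, y n δ = y (n + 1) 0) :
    SolvesODE (fun t => B ⌊t / δ⌋₊) (fun t => y ⌊t / δ⌋₊ (t - ⌊t / δ⌋₊ * δ)) := by
  set g : ℝ → Fin d → ℝ :=
    fun t => (B ⌊t / δ⌋₊).mulVec (y ⌊t / δ⌋₊ (t - ⌊t / δ⌋₊ * δ)) with hg
  have hyc : ∀ n, Continuous (y n) := fun n =>
    continuous_iff_continuousAt.2 fun τ => (hy n τ).continuousAt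
  have hgc : ∀ n, Continuous fun s => (B n).mulVec (y n (s - n * δ)) := fun n =>
    Continuous.matrix_mulVec continuous_const ((hyc n).comp (by fun_prop))
  have hfloor : ∀ (n : ℕ) (t : ℝ), n * δ ≤ t → t < (n + 1) * δ → ⌊t / δ⌋₊ = n := by
    intro n t h1 h2
    rw [Nat.floor_eq_iff (div_nonneg ((by positivity : 0 ≤ n * δ).trans h1) hδ.le),
      le_div_iff₀ hδ, div_lt_iff₀ hδ]
    exact ⟨h1, h2⟩
  have hgn : ∀ (n : ℕ) (t : ℝ), n * δ ≤ t → t < (n + 1) * δ →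
      g t = (B n).mulVec (y n (t - n * δ)) := by
    intro n t h1 h2
    simp only [hg, hfloor n t h1 h2]
  have hpiece : ∀ (n : ℕ) (τ : ℝ), 0 ≤ τ → τ ≤ δ →
      IntervalIntegrable g volume (n * δ) (n * δ + τ) ∧
        ∫ s in (n * δ)..(n * δ + τ), g s = y n τ - y n 0 := by
    intro n τ h0 h1
    have hI : IntervalIntegrable g volume (n * δ) (n * δ + τ) := by
      apply ((hgc n).intervalIntegrable (n * δ) (n * δ + τ)).congr_uIoo
      rw [uIoo_of_le (by linarith)]
      intro t ht
      exact (hgn n t ht.1.le (by linarith [ht.2])).symm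
    refine ⟨hI, ?_⟩
    rw [intervalIntegral.integral_eq_sub_of_hasDerivAt_of_le (f := fun s => y n (s - n * δ))
      (by linarith) ((hyc n).comp (by fun_prop)).continuousOn ?_ hI]
    · simp
    · intro t ht
      rw [hgn n t ht.1.le (by linarith [ht.2])]
      simpa using (hy n (t - n * δ)).comp_sub_const t (n * δ)
  have hind : ∀ n : ℕ, IntervalIntegrable g volume 0 (n * δ) ∧
      y n 0 = y 0 0 + ∫ s in (0 : ℝ)..(n * δ), g s := by
    intro n
    induction n with
    | zero => simp
    | succ n ih =>
      have hp := hpiece n δ hδ.le le_rfl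
      have e : ((n + 1 : ℕ) : ℝ) * δ = n * δ + δ := by push_cast; ring
      rw [e]
      refine ⟨ih.1.trans hp.1, ?_⟩
      rw [← intervalIntegral.integral_add_adjacent_intervals ih.1 hp.1, hp.2, ← hglue,
        ih.2]
      abel
  have hmain : ∀ t, 0 ≤ t → IntervalIntegrable g volume 0 t ∧
      y ⌊t / δ⌋₊ (t - ⌊t / δ⌋₊ * δ) = y 0 0 + ∫ s in (0 : ℝ)..t, g s := by
    intro t ht
    have h1 : (⌊t / δ⌋₊ : ℝ) * δ ≤ t :=
      (le_div_iff₀ hδ).1 (Nat.floor_le (div_nonneg ht hδ.le))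
    have h2 : t < (⌊t / δ⌋₊ + 1 : ℝ) * δ := (div_lt_iff₀ hδ).1 (Nat.lt_floor_add_one _)
    set n := ⌊t / δ⌋₊
    have hp := hpiece n (t - n * δ) (by linarith) (by linarith)
    rw [add_sub_cancel] at hp
    refine ⟨(hind n).1.trans hp.1, ?_⟩
    rw [← intervalIntegral.integral_add_adjacent_intervals (hind n).1 hp.1, hp.2,
      ← add_assoc, ← (hind n).2]
    abel
  -- Continuity of the primitive requires integrability on every interval. At negative times the
  -- natural floor is 0, so the integrand is the extension of the first piece.
  have hneg : ∀ t, t ≤ 0 → IntervalIntegrable g volume 0 t := by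
    intro t ht
    apply ((hgc 0).intervalIntegrable 0 t).congr_uIoo
    rw [uIoo_of_ge ht]
    intro s hs
    have : ⌊s / δ⌋₊ = 0 := Nat.floor_of_nonpos (div_nonpos_of_nonpos_of_nonneg hs.2.le hδ.le)
    simp [hg, this]
  have hall : ∀ t, IntervalIntegrable g volume 0 t := fun t =>
    (le_total 0 t).elim (fun h => (hmain t h).1) (hneg t)
  refine ⟨?_, fun t ht => (hmain t ht).1, ?_⟩
  · have hc : Continuous fun t => y 0 0 + ∫ s in (0 : ℝ)..t, g s :=
      continuous_const.add
        (intervalIntegral.continuous_primitive (fun a b => (hall a).symm.trans (hall b)) 0)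
    exact hc.continuousOn.congr fun t ht => (hmain t ht).2
  · intro t ht
    simpa using (hmain t ht).2

open scoped Matrix.Norms.Operator in
/-- The solution `exp (t B) x` of `y' = B y`, written with a shift `k` of the diagonal. -/
def shiftedFlow {d : ℕ} (k : ℝ) (B : Matrix (Fin d) (Fin d) ℝ) (x : Fin d → ℝ) (t : ℝ) :
    Fin d → ℝ :=
  Real.exp (-k * t) • (NormedSpace.exp (t • (B + k • (1 : Matrix (Fin d) (Fin d) ℝ)))).mulVec x

theorem shiftedFlow_zero {d : ℕ} (k : ℝ) (B : Matrix (Fin d) (Fin d) ℝ) (x : Fin d → ℝ) :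
    shiftedFlow k B x 0 = x := by
  simp [shiftedFlow]

open scoped Matrix.Norms.Operator in
theorem hasDerivAt_shiftedFlow {d : ℕ} (k : ℝ) (B : Matrix (Fin d) (Fin d) ℝ) (x : Fin d → ℝ)
    (t : ℝ) : HasDerivAt (shiftedFlow k B x) (B.mulVec (shiftedFlow k B x t)) t := by
  have h1 := hasDerivAt_exp_smul_const' (𝕂 := ℝ) (B + k • (1 : Matrix (Fin d) (Fin d) ℝ)) t
  let f : Matrix (Fin d) (Fin d) ℝ →L[ℝ] (Fin d → ℝ) :=
    LinearMap.toContinuousLinearMap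
      ((LinearMap.applyₗ x).comp (Matrix.toLin' (R := ℝ) (m := Fin d) (n := Fin d)).toLinearMap)
  have h2 : HasDerivAt
      (fun u : ℝ => (NormedSpace.exp (u • (B + k • (1 : Matrix (Fin d) (Fin d) ℝ)))).mulVec x)
      (((B + k • (1 : Matrix (Fin d) (Fin d) ℝ)) *
        NormedSpace.exp (t • (B + k • (1 : Matrix (Fin d) (Fin d) ℝ)))).mulVec x) t := f.hasFDerivAt.comp_hasDerivAt t h1
  have h3 : HasDerivAt (fun t : ℝ => Real.exp (-k * t)) (Real.exp (-k * t) * (-k)) t := by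
    simpa using ((hasDerivAt_id t).const_mul (-k)).exp
  have h4 : HasDerivAt (shiftedFlow k B x) _ t := h3.smul h2
  refine h4.congr_deriv ?_
  simp only [shiftedFlow, ← Matrix.mulVec_mulVec, Matrix.add_mulVec,
    Matrix.smul_mulVec, Matrix.one_mulVec, Matrix.mulVec_smul]
  module

theorem Matrix.pow_nonneg_entries {d : ℕ} {M : Matrix (Fin d) (Fin d) ℝ}
    (hM : ∀ i j, 0 ≤ M i j) (n : ℕ) : ∀ i j, 0 ≤ (M ^ n) i j := by
  induction n with
  | zero =>
    intro i j
    rw [pow_zero, Matrix.one_apply]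
    split_ifs <;> norm_num
  | succ n ih =>
    intro i j
    rw [pow_succ, Matrix.mul_apply]
    exact Finset.sum_nonneg fun l _ => mul_nonneg (ih i l) (hM l j)

theorem Matrix.mulVec_nonneg_of_entries {d : ℕ} {M : Matrix (Fin d) (Fin d) ℝ}
    (hM : ∀ i j, 0 ≤ M i j) {x : Fin d → ℝ} (hx : 0 ≤ x) : 0 ≤ M.mulVec x := fun i => by
  show 0 ≤ ∑ j, M i j * x j
  exact Finset.sum_nonneg fun j _ => mul_nonneg (hM i j) (hx j)

-- All terms of the exponential series contribute nonnegatively, so truncation after the linear term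
-- is a lower bound.
open scoped Matrix.Norms.Operator in
theorem Matrix.dotProduct_add_le_exp {d : ℕ} {M : Matrix (Fin d) (Fin d) ℝ}
    (hM : ∀ i j, 0 ≤ M i j) {w x : Fin d → ℝ} (hw : 0 ≤ w) (hx : 0 ≤ x) :
    w ⬝ᵥ x + w ⬝ᵥ M.mulVec x ≤ w ⬝ᵥ (NormedSpace.exp M).mulVec x := by
  let f : Matrix (Fin d) (Fin d) ℝ →ₗ[ℝ] ℝ :=
    { toFun := fun M => w ⬝ᵥ M.mulVec x
      map_add' := fun A B => by rw [Matrix.add_mulVec, dotProduct_add]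
      map_smul' := fun c A => by rw [Matrix.smul_mulVec, dotProduct_smul]; rfl }
  have hsum := (NormedSpace.exp_series_hasSum_exp' (𝕂 := ℝ) M).mapL f.toContinuousLinearMap
  have hle := sum_le_hasSum (Finset.range 2) (fun n _ => ?_) hsum
  · simp only [Finset.sum_range_succ, Finset.sum_range_zero] at hle
    simp only [zero_add, pow_zero, pow_one, Nat.factorial_zero, Nat.factorial_one, Nat.cast_one,
      inv_one, one_smul] at hle
    simpa only [f, LinearMap.coe_toContinuousLinearMap', LinearMap.coe_mk, AddHom.coe_mk,
      Matrix.one_mulVec] using! hle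
  · show 0 ≤ w ⬝ᵥ ((n.factorial⁻¹ : ℝ) • M ^ n).mulVec x
    rw [Matrix.smul_mulVec, dotProduct_smul]
    exact mul_nonneg (by positivity)
      (dotProduct_nonneg_of_nonneg hw
        (Matrix.mulVec_nonneg_of_entries (Matrix.pow_nonneg_entries hM n) hx))

/-- The shift k makes the matrix entrywise nonnegative, so the truncated exponential bounds the
growth of w · x over one step from below. -/
theorem le_dotProduct_shiftedFlow {d : ℕ} {k : ℝ} {B : Matrix (Fin d) (Fin d) ℝ}
    (hB : ∀ i j, 0 ≤ (B + k • (1 : Matrix (Fin d) (Fin d) ℝ)) i j) {w x : Fin d → ℝ}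
    (hw : 0 ≤ w) (hx : 0 ≤ x) {t : ℝ} (ht : 0 ≤ t) :
    Real.exp (-k * t) * (w ⬝ᵥ x + t * (w ⬝ᵥ B.mulVec x + k * (w ⬝ᵥ x))) ≤
      w ⬝ᵥ shiftedFlow k B x t := by
  have h := Matrix.dotProduct_add_le_exp
    (M := t • (B + k • (1 : Matrix (Fin d) (Fin d) ℝ)))
    (fun i j => mul_nonneg ht (hB i j)) hw hx
  rw [shiftedFlow, dotProduct_smul, smul_eq_mul]
  refine mul_le_mul_of_nonneg_left (le_trans (le_of_eq ?_) h) (Real.exp_pos _).le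
  simp only [Matrix.smul_mulVec, Matrix.add_mulVec, Matrix.one_mulVec, dotProduct_smul,
    dotProduct_add, smul_eq_mul]

theorem shiftedFlow_nonneg {d : ℕ} {k : ℝ} {B : Matrix (Fin d) (Fin d) ℝ}
    (hB : ∀ i j, 0 ≤ (B + k • (1 : Matrix (Fin d) (Fin d) ℝ)) i j) {x : Fin d → ℝ}
    (hx : 0 ≤ x) {t : ℝ} (ht : 0 ≤ t) : 0 ≤ shiftedFlow k B x t := by
  intro i
  have hw : (0 : Fin d → ℝ) ≤ Pi.single i 1 := by
    intro j
    by_cases h : j = i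
    · subst h; simp
    · simp [h]
  have h := le_dotProduct_shiftedFlow hB hw hx ht
  have hBx := Matrix.mulVec_nonneg_of_entries hB hx i
  simp only [Matrix.add_mulVec, Matrix.smul_mulVec, Matrix.one_mulVec, Pi.add_apply,
    Pi.smul_apply, smul_eq_mul, Pi.zero_apply] at hBx
  simp only [single_dotProduct, one_mul] at h
  have hxi := hx i
  simp only [Pi.zero_apply] at hxi ⊢
  exact le_trans (by positivity) h

/-! ### Lower bound for the growth rate -/

/-- If all trajectories are `O(exp (s t))`, then `s` is at least every growth rate `l` that can be
kept up, with respect to a nonnegative functional `w`, by a feedback choice of the matrix. -/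
theorem le_of_forall_trajectory_bounded {d : ℕ} {𝒜 : Set (Matrix (Fin d) (Fin d) ℝ)}
    (hcompact : IsCompact 𝒜) (hpos : IsPositiveSystem 𝒜) {s l : ℝ}
    (hs : ∀ x, IsTrajectory 𝒜 x → ∃ C : ℝ, ∀ t, 0 ≤ t → ‖x t‖ ≤ C * Real.exp (s * t))
    {w : Fin d → ℝ} (hw : 0 ≤ w) (hw0 : w ≠ 0)
    (hl : ∀ x, 0 ≤ x → ∃ B ∈ 𝒜, l * (w ⬝ᵥ x) ≤ w ⬝ᵥ B.mulVec x) : l ≤ s := by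
  by_contra! hlt
  choose! β hβ hβl using hl
  obtain ⟨k₀, -, hk₀⟩ := hcompact.exists_entries_bound
  -- The shift must make every B + kI nonnegative and also keep a = m + k positive, where m is the
  -- midpoint of s and l.
  obtain ⟨k, hk1, hk2⟩ : ∃ k, k₀ ≤ k ∧ 0 < (s + l) / 2 + k :=
    ⟨max k₀ (1 - (s + l) / 2), le_max_left _ _, by
      linarith [le_max_right k₀ (1 - (s + l) / 2)]⟩
  have hB : ∀ B ∈ 𝒜, ∀ i j, 0 ≤ (B + k • (1 : Matrix (Fin d) (Fin d) ℝ)) i j := by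
    intro B hB i j
    by_cases hij : i = j
    · subst hij
      have := (abs_le.1 (hk₀ B hB i i)).1
      simp
      linarith
    · simpa [Matrix.one_apply_ne hij] using hpos B hB i j hij
  set m := (s + l) / 2 with hm
  set a := m + k with ha
  set η := l - m with hη
  have hηpos : 0 < η := by rw [hη, hm]; linarith
  -- With this δ, (1 - aδ)(1 + δ(a + η)) = 1, so one sampling step multiplies w · x by at least
  -- exp(mδ).
  set δ := η / (a * (a + η)) with hδd
  have hδ : 0 < δ := by positivity
  have hstep : Real.exp (m * δ) ≤ Real.exp (-k * δ) * (1 + δ * (l + k)) := by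
    have e1 : Real.exp (-k * δ) = Real.exp (m * δ) * Real.exp (-(a * δ)) := by
      rw [← Real.exp_add]; congr 1; rw [ha]; ring
    have e2 : l + k = a + η := by rw [ha, hη]; ring
    have e3 : δ * (a * (a + η)) = η := by rw [hδd]; field_simp
    have e4 : 1 - a * δ ≤ Real.exp (-(a * δ)) := Real.one_sub_le_exp_neg _
    rw [e1, e2, mul_assoc]
    refine le_mul_of_one_le_right (Real.exp_pos _).le ?_
    have hnn : 0 ≤ 1 + δ * (a + η) := by positivity
    calc (1 : ℝ) = (1 - a * δ) * (1 + δ * (a + η)) := by linear_combination δ * e3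
      _ ≤ _ := mul_le_mul_of_nonneg_right e4 hnn
  -- States at the times nδ: the matrix selected at a state is kept for the next time δ.
  let X : ℕ → Fin d → ℝ := fun n =>
    Nat.rec w (fun _ x => shiftedFlow k (β x) x δ) n
  have hX0 : X 0 = w := rfl
  have hXs : ∀ n, X (n + 1) = shiftedFlow k (β (X n)) (X n) δ := fun n => rfl
  have hXnn : ∀ n, 0 ≤ X n := by
    intro n
    induction n with
    | zero => exact hw
    | succ n ih =>
      rw [hXs]
      exact shiftedFlow_nonneg (hB _ (hβ _ ih)) ih hδ.le
  have hgrow : ∀ n : ℕ, Real.exp (m * δ * n) * (w ⬝ᵥ w) ≤ w ⬝ᵥ X n := by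
    intro n
    induction n with
    | zero => simp [hX0]
    | succ n ih =>
      have hwx : 0 ≤ w ⬝ᵥ X n := dotProduct_nonneg_of_nonneg hw (hXnn n)
      have h1 := le_dotProduct_shiftedFlow (hB _ (hβ _ (hXnn n))) hw (hXnn n) hδ.le
      rw [hXs]
      refine le_trans ?_ h1
      have e : Real.exp (m * δ * (n + 1 : ℕ)) = Real.exp (m * δ) * Real.exp (m * δ * n) := by
        rw [← Real.exp_add]; congr 1; push_cast; ring
      calc Real.exp (m * δ * (n + 1 : ℕ)) * (w ⬝ᵥ w)
          = Real.exp (m * δ) * (Real.exp (m * δ * n) * (w ⬝ᵥ w)) := by rw [e, mul_assoc]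
        _ ≤ Real.exp (m * δ) * (w ⬝ᵥ X n) :=
            mul_le_mul_of_nonneg_left ih (Real.exp_pos _).le
        _ ≤ Real.exp (-k * δ) * (1 + δ * (l + k)) * (w ⬝ᵥ X n) :=
            mul_le_mul_of_nonneg_right hstep hwx
        _ = Real.exp (-k * δ) * (w ⬝ᵥ X n + δ * (l * (w ⬝ᵥ X n) + k * (w ⬝ᵥ X n))) := by ring
        _ ≤ _ := by
            have := hβl (X n) (hXnn n)
            gcongr
  have hode := solvesODE_concat (B := fun n => β (X n))
    (y := fun n => shiftedFlow k (β (X n)) (X n)) hδ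
    (fun n τ => hasDerivAt_shiftedFlow k _ _ τ)
    (fun n => by rw [shiftedFlow_zero, hXs])
  have hlaw : IsSwitchingLaw 𝒜 fun t => β (X ⌊t / δ⌋₊) := by
    refine ⟨fun i j => ?_, fun t _ => hβ _ (hXnn _)⟩
    exact (measurable_from_nat (f := fun n => β (X n) i j)).comp
      (Nat.measurable_floor.comp (measurable_id.div_const δ))
  obtain ⟨C, hC⟩ := hs _ ⟨_, hlaw, hode⟩
  have hbound : ∀ n : ℕ, Real.exp (m * δ * n) * (w ⬝ᵥ w) ≤
      (∑ i, w i) * C * Real.exp (s * δ * n) := by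
    intro n
    have h := hC (n * δ) (by positivity)
    have e : (n : ℝ) * δ / δ = n := by field_simp
    simp only [e, Nat.floor_natCast, sub_self, shiftedFlow_zero] at h
    refine (hgrow n).trans ?_
    have e2 : s * δ * n = s * (n * δ) := by ring
    rw [e2, mul_assoc, Finset.sum_mul]
    refine Finset.sum_le_sum fun i _ => mul_le_mul_of_nonneg_left ?_ (hw i)
    exact (le_abs_self _).trans ((norm_le_pi_norm (X n) i).trans h)
  have hww : 0 < w ⬝ᵥ w := by
    obtain ⟨i, hi⟩ := Function.ne_iff.1 hw0
    exact Finset.sum_pos' (fun j _ => mul_self_nonneg _) ⟨i, Finset.mem_univ i,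
      mul_self_pos.2 hi⟩
  have hc : 0 < (m - s) * δ := mul_pos (by rw [hm]; linarith) hδ
  obtain ⟨n, hn⟩ := exists_nat_gt ((∑ i, w i) * C / (w ⬝ᵥ w) / ((m - s) * δ))
  rw [div_lt_iff₀ hc, div_lt_iff₀ hww] at hn
  have h1 := hbound n
  have e : Real.exp (m * δ * n) = Real.exp (n * ((m - s) * δ)) * Real.exp (s * δ * n) := by
    rw [← Real.exp_add]; congr 1; ring
  rw [e, mul_right_comm, mul_le_mul_iff_left₀ (Real.exp_pos _)] at h1
  have h2 := Real.add_one_le_exp (n * ((m - s) * δ))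
  nlinarith

/-- The exponential growth bound of a planar positive system is not less than the Perron root of
any matrix of the convex hull. -/
theorem IsPositiveSystem.perronRoot_le {𝒜 : Set (Matrix (Fin 2) (Fin 2) ℝ)}
    (hpos : IsPositiveSystem 𝒜) (hcompact : IsCompact 𝒜) {s : ℝ}
    (hs : ∀ x, IsTrajectory 𝒜 x → ∃ C : ℝ, ∀ t, 0 ≤ t → ‖x t‖ ≤ C * Real.exp (s * t))
    {A : Matrix (Fin 2) (Fin 2) ℝ} (hA : A ∈ convexHull ℝ 𝒜) : perronRoot A ≤ s := by
  obtain ⟨w, hw, hw0, hwA⟩ := (hpos.isMetzler_of_mem_convexHull hA).transpose.exists_eigenvector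
  rw [perronRoot_transpose, Matrix.mulVec_transpose] at hwA
  refine le_of_forall_trajectory_bounded hcompact hpos hs hw hw0 fun x hx => ?_
  by_contra! hlt
  -- If every matrix of 𝒜 failed at x, so would A, by convexity of the half-space; but the left
  -- eigenvector gives equality for A.
  let C : Set (Matrix (Fin 2) (Fin 2) ℝ) :=
    {B | w ⬝ᵥ B.mulVec x < perronRoot A * (w ⬝ᵥ x)}
  have hC : Convex ℝ C := by
    refine convex_halfSpace_lt (f := fun B : Matrix (Fin 2) (Fin 2) ℝ => w ⬝ᵥ B.mulVec x)
      ⟨fun A B => ?_, fun c A => ?_⟩ _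
    · rw [Matrix.add_mulVec, dotProduct_add]
    · rw [Matrix.smul_mulVec, dotProduct_smul]
  have h : w ⬝ᵥ A.mulVec x < perronRoot A * (w ⬝ᵥ x) :=
    convexHull_min (fun B hB => hlt B hB) hC hA
  rw [Matrix.dotProduct_mulVec, hwA, smul_dotProduct, smul_eq_mul] at h
  exact h.false

/-! ### Increments of trajectories and of their absolute values -/

theorem Matrix.norm_mulVec_le_of_entries {d : ℕ} {B : Matrix (Fin d) (Fin d) ℝ} {K : ℝ}
    (hK : 0 ≤ K) (hB : ∀ i j, |B i j| ≤ K) (x : Fin d → ℝ) :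
    ‖B.mulVec x‖ ≤ d * K * ‖x‖ := by
  refine (pi_norm_le_iff_of_nonneg (by positivity)).2 fun i => ?_
  calc ‖B.mulVec x i‖ ≤ ∑ j, ‖B i j * x j‖ :=
        norm_sum_le Finset.univ fun j => B i j * x j
    _ ≤ ∑ _j : Fin d, K * ‖x‖ := Finset.sum_le_sum fun j _ => by
        rw [norm_mul]
        exact mul_le_mul (hB i j) (norm_le_pi_norm x j) (norm_nonneg _) hK
    _ = d * K * ‖x‖ := by simp [mul_assoc]

theorem Matrix.mulVec_le_mulVec_of_entries {d : ℕ} {A B : Matrix (Fin d) (Fin d) ℝ}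
    (hAB : ∀ i j, B i j ≤ A i j) {v : Fin d → ℝ} (hv : 0 ≤ v) : B.mulVec v ≤ A.mulVec v := by
  intro i
  show ∑ j, B i j * v j ≤ ∑ j, A i j * v j
  exact Finset.sum_le_sum fun j _ => mul_le_mul_of_nonneg_right (hAB i j) (hv j)

/-- Every trajectory has, at every time and not only almost everywhere, its right derivatives in
the convex hull of the admissible velocities. -/
theorem SolvesODE.eventually_increment {d : ℕ} {𝒞 : Set (Matrix (Fin d) (Fin d) ℝ)}
    (hcomp : IsCompact 𝒞) (hconv : Convex ℝ 𝒞) {L : ℝ → Matrix (Fin d) (Fin d) ℝ}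
    (hL : IsSwitchingLaw 𝒞 L) {x : ℝ → Fin d → ℝ} (hx : SolvesODE L x) {t : ℝ} (ht : 0 ≤ t)
    {η : ℝ} (hη : 0 < η) :
    ∀ᶠ u in 𝓝[>] t, ∃ A ∈ 𝒞, ‖x u - x t - (u - t) • A.mulVec (x t)‖ ≤ η * (u - t) := by
  obtain ⟨K, hK0, hK⟩ := hcomp.exists_entries_bound
  have hcont : ContinuousWithinAt x (Ici t) t :=
    (hx.continuousOn t ht).mono (Ici_subset_Ici.2 ht)
  have hclose : ∀ᶠ s in 𝓝[≥] t, ‖x s - x t‖ ≤ η / (d * K + 1) := by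
    have hpos : 0 < η / (d * K + 1) := by positivity
    have := (Metric.tendsto_nhds.1 hcont) _ hpos
    filter_upwards [this] with s hs
    rw [dist_eq_norm] at hs
    exact hs.le
  obtain ⟨u₀, hu₀, hsub⟩ := mem_nhdsGE_iff_exists_Ico_subset.1 hclose
  filter_upwards [Ioo_mem_nhdsGT hu₀] with u hu
  have htu : t < u := hu.1
  let L' : ℝ → Fin d → Fin d → ℝ := L
  have hLm : Measurable L' :=
    measurable_pi_iff.2 fun i => measurable_pi_iff.2 fun j => hL.measurable i j
  have hLi : IntegrableOn L' (Ioc t u) := by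
    refine Measure.integrableOn_of_bounded (M := K) (by simp) hLm.aestronglyMeasurable ?_
    filter_upwards [ae_restrict_mem measurableSet_Ioc] with s hs
    exact (pi_norm_le_iff_of_nonneg hK0).2 fun i => (pi_norm_le_iff_of_nonneg hK0).2 fun j =>
      hK _ (hL.mem s (ht.trans hs.1.le)) i j
  let 𝒞' : Set (Fin d → Fin d → ℝ) := 𝒞
  have hconv' : Convex ℝ 𝒞' := hconv
  have hclosed' : IsClosed 𝒞' := hcomp.isClosed
  -- The mean of the switching law over (t, u] stays in the closed convex set; freezing x at time t
  -- costs at most η(u - t).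
  set M : Fin d → Fin d → ℝ := ⨍ s in Ioc t u, L' s with hMdef
  have hmem : M ∈ 𝒞' := by
    refine hconv'.set_average_mem hclosed' (by simp [htu]) (by simp) ?_ hLi
    filter_upwards [ae_restrict_mem measurableSet_Ioc] with s hs
    exact hL.mem s (ht.trans hs.1.le)
  refine ⟨_, hmem, ?_⟩
  let φ : (Fin d → Fin d → ℝ) →L[ℝ] (Fin d → ℝ) := LinearMap.toContinuousLinearMap
    { toFun := fun M => Matrix.mulVec M (x t)
      map_add' := fun M N => Matrix.add_mulVec M N (x t)
      map_smul' := fun c M => Matrix.smul_mulVec c (M : Matrix (Fin d) (Fin d) ℝ) (x t) }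
  have hφ : ∀ M, φ M = Matrix.mulVec M (x t) := fun M => rfl
  have h1 : (u - t) • Matrix.mulVec M (x t) =
      ∫ s in t..u, (L s).mulVec (x t) := by
    rw [← hφ, hMdef, setAverage_eq, map_smul, ← φ.integral_comp_comm hLi,
      intervalIntegral.integral_of_le htu.le]
    simp only [hφ, Real.volume_real_Ioc_of_le htu.le]
    rw [smul_smul, mul_inv_cancel₀ (by linarith), one_smul]
  have hI1 : IntervalIntegrable (fun s => (L s).mulVec (x s)) volume t u :=
    (hx.integrable t ht).symm.trans (hx.integrable u (ht.trans htu.le))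
  have hI2 : IntervalIntegrable (fun s => (L s).mulVec (x t)) volume t u := by
    rw [intervalIntegrable_iff_integrableOn_Ioc_of_le htu.le]
    exact φ.integrable_comp hLi
  have h2 : x u - x t = ∫ s in t..u, (L s).mulVec (x s) := by
    rw [hx.eq t ht, hx.eq u (ht.trans htu.le),
      ← intervalIntegral.integral_add_adjacent_intervals (hx.integrable t ht) hI1]
    abel
  rw [h1, h2, ← intervalIntegral.integral_sub hI1 hI2]
  have hb : ∀ s ∈ uIoc t u, ‖(L s).mulVec (x s) - (L s).mulVec (x t)‖ ≤ η := by
    intro s hs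
    rw [uIoc_of_le htu.le] at hs
    rw [← Matrix.mulVec_sub]
    have hxs : ‖x s - x t‖ ≤ η / (d * K + 1) := hsub ⟨hs.1.le, hs.2.trans_lt hu.2⟩
    calc _ ≤ d * K * ‖x s - x t‖ := Matrix.norm_mulVec_le_of_entries hK0
          (hK _ (hL.mem s (ht.trans hs.1.le))) _
      _ ≤ d * K * (η / (d * K + 1)) := by gcongr
      _ ≤ η := by
        rw [mul_div_assoc', div_le_iff₀ (by positivity)]
        nlinarith
  have := intervalIntegral.norm_integral_le_of_norm_le_const hb
  rwa [abs_of_pos (by linarith)] at this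

/-- The matrices whose diagonal is that of a matrix of `𝒞` and whose off-diagonal entries are
dominated by it in absolute value. -/
def offDiagDominated (𝒞 : Set (Matrix (Fin 2) (Fin 2) ℝ)) : Set (Matrix (Fin 2) (Fin 2) ℝ) :=
  {B | ∃ A ∈ 𝒞, (∀ i, B i i = A i i) ∧ ∀ i j, i ≠ j → |B i j| ≤ A i j}

theorem convex_offDiagDominated {𝒞 : Set (Matrix (Fin 2) (Fin 2) ℝ)} (h : Convex ℝ 𝒞) :
    Convex ℝ (offDiagDominated 𝒞) := by
  rintro B ⟨A, hA, hd, ho⟩ B' ⟨A', hA', hd', ho'⟩ a b ha hb hab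
  refine ⟨_, h hA hA' ha hb hab, fun i => ?_, fun i j hij => ?_⟩
  · simp [hd i, hd' i]
  · simp only [Matrix.add_apply, Matrix.smul_apply, smul_eq_mul]
    refine (abs_add_le _ _).trans ?_
    rw [abs_mul, abs_mul, abs_of_nonneg ha, abs_of_nonneg hb]
    exact add_le_add (mul_le_mul_of_nonneg_left (ho i j hij) ha)
      (mul_le_mul_of_nonneg_left (ho' i j hij) hb)

/-- The dominated entries are the multiples γ * A i j with γ ∈ [-1, 1], so the set is a continuous
image of a compact product. -/
theorem isCompact_offDiagDominated {𝒞 : Set (Matrix (Fin 2) (Fin 2) ℝ)} (h : IsCompact 𝒞)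
    (hM : ∀ A ∈ 𝒞, IsMetzler A) : IsCompact (offDiagDominated 𝒞) := by
  have hK : IsCompact (𝒞 ×ˢ (Icc (-1 : ℝ) 1 ×ˢ Icc (-1 : ℝ) 1)) :=
    h.prod (isCompact_Icc.prod isCompact_Icc)
  have hc : Continuous fun p : Matrix (Fin 2) (Fin 2) ℝ × ℝ × ℝ =>
      !![p.1 0 0, p.2.1 * p.1 0 1; p.2.2 * p.1 1 0, p.1 1 1] := by
    refine continuous_matrix fun i j => ?_
    fin_cases i <;> fin_cases j <;> simp <;> fun_prop
  have hdiv : ∀ a b : ℝ, |b| ≤ a → b / a ∈ Icc (-1 : ℝ) 1 ∧ b / a * a = b := by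
    intro a b hab
    rcases ((abs_nonneg b).trans hab).eq_or_lt with h0 | h0
    · subst h0
      simp [abs_nonpos_iff.1 hab]
    · rw [abs_le] at hab
      refine ⟨⟨?_, ?_⟩, div_mul_cancel₀ _ h0.ne'⟩
      · rw [le_div_iff₀ h0]; linarith
      · rw [div_le_iff₀ h0]; linarith
  convert hK.image hc
  ext B
  constructor
  · rintro ⟨A, hA, hd, ho⟩
    obtain ⟨m1, e1⟩ := hdiv _ _ (ho 0 1 (by decide))
    obtain ⟨m2, e2⟩ := hdiv _ _ (ho 1 0 (by decide))
    refine ⟨(A, B 0 1 / A 0 1, B 1 0 / A 1 0), ⟨hA, m1, m2⟩, ?_⟩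
    ext i j
    fin_cases i <;> fin_cases j <;> simp [hd, e1, e2]
  · rintro ⟨⟨A, α, β⟩, ⟨hA, hα, hβ⟩, rfl⟩
    have hmul : ∀ γ ∈ Icc (-1 : ℝ) 1, ∀ a : ℝ, 0 ≤ a → |γ * a| ≤ a := by
      intro γ hγ a ha
      rw [abs_mul, abs_of_nonneg ha]
      exact mul_le_of_le_one_left ha (abs_le.2 hγ)
    refine ⟨A, hA, fun i => ?_, fun i j hij => ?_⟩
    · fin_cases i <;> simp
    · have h01 := hM A hA 0 1 (by decide)
      have h10 := hM A hA 1 0 (by decide)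
      fin_cases i <;> fin_cases j <;> simp [-abs_mul] at hij ⊢
      · exact hmul _ hα _ h01
      · exact hmul _ hβ _ h10

/-- The number b is q / (h * z) clamped to [-a, a]. It supplies the off-diagonal entry that accounts
for the change of |x i|. -/
theorem exists_abs_le_and_abs_sub_le {q h a z e : ℝ} (hh : 0 < h) (ha : 0 ≤ a) (hz : 0 ≤ z)
    (he : 0 ≤ e) (hq : |q| ≤ h * a * z + e) : ∃ b, |b| ≤ a ∧ |q - h * b * z| ≤ e := by
  obtain ⟨h1, h2⟩ := abs_le.1 hq
  by_cases c1 : h * a * z ≤ q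
  · exact ⟨a, (abs_of_nonneg ha).le, by rw [abs_of_nonneg] <;> linarith⟩
  by_cases c2 : q ≤ -(h * a * z)
  · refine ⟨-a, by rw [abs_neg, abs_of_nonneg ha], ?_⟩
    rw [abs_of_nonpos] <;> linarith
  have hz' : 0 < z := by
    refine hz.lt_of_ne fun h0 => ?_
    subst h0
    simp at c1 c2
    linarith
  refine ⟨q / (h * z), ?_, ?_⟩
  · rw [abs_le, le_div_iff₀ (by positivity), div_le_iff₀ (by positivity)]
    constructor <;> nlinarith
  · have : h * (q / (h * z)) * z = q := by field_simp
    rw [this, sub_self, abs_zero]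
    exact he

/-- The vector of absolute values of a trajectory of a planar positive system follows the system
with dominated off-diagonal entries. -/
theorem SolvesODE.eventually_abs_increment {𝒞 : Set (Matrix (Fin 2) (Fin 2) ℝ)}
    (hcomp : IsCompact 𝒞) (hconv : Convex ℝ 𝒞) (hM : ∀ A ∈ 𝒞, IsMetzler A)
    {L : ℝ → Matrix (Fin 2) (Fin 2) ℝ}
    (hL : IsSwitchingLaw 𝒞 L) {x : ℝ → Fin 2 → ℝ} (hx : SolvesODE L x) {t : ℝ} (ht : 0 ≤ t)
    {η : ℝ} (hη : 0 < η) :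
    ∀ᶠ u in 𝓝[>] t, ∃ B ∈ offDiagDominated 𝒞,
      ‖|x u| - |x t| - (u - t) • B.mulVec |x t|‖ ≤ η * (u - t) := by
  obtain ⟨K, hK0, hK⟩ := hcomp.exists_entries_bound
  -- On so short a step 1 + h * A i i ≥ 0, so this factor can be moved inside the absolute value.
  have hsmall : t < t + 1 / (K + 1) := by
    have : 0 < 1 / (K + 1) := by positivity
    linarith
  filter_upwards [hx.eventually_increment hcomp hconv hL ht hη, Ioo_mem_nhdsGT hsmall]
    with u ⟨A, hA, hu⟩ hu'
  have hh : 0 < u - t := sub_pos.2 hu'.1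
  have hhK : (u - t) * (K + 1) < 1 := by
    rw [← lt_div_iff₀ (by positivity)]
    linarith [hu'.2]
  generalize u - t = h at *
  have he : 0 ≤ η * h := by positivity
  rw [pi_norm_le_iff_of_nonneg he] at hu
  have key : ∀ i j, i ≠ j → ∃ b, |b| ≤ A i j ∧
      |(|x u i| - (1 + h * A i i) * |x t i|) - h * b * (|x t j|)| ≤ η * h := by
    intro i j hij
    have hAij := hM A hA i j hij
    refine exists_abs_le_and_abs_sub_le hh hAij (abs_nonneg _) he ?_
    have hi := hu i
    have hsum : A.mulVec (x t) i = A i i * x t i + A i j * x t j := by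
      have : ∀ i j : Fin 2, i ≠ j → ∀ f : Fin 2 → ℝ, ∑ k, f k = f i + f j := by
        intro i j hij f
        fin_cases i <;> fin_cases j <;> simp [Fin.sum_univ_two, add_comm] at hij ⊢
      exact this i j hij fun k => A i k * x t k
    simp only [Pi.sub_apply, Pi.smul_apply, smul_eq_mul, hsum, Real.norm_eq_abs] at hi
    have hAii := (abs_le.1 (hK A hA i i)).1
    have hpos : 0 ≤ 1 + h * A i i := by nlinarith
    have e1 : (1 + h * A i i) * |x t i| = |(1 + h * A i i) * x t i| := by
      rw [abs_mul, abs_of_nonneg hpos]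
    have e2 : h * A i j * |x t j| = |h * A i j * x t j| := by
      rw [abs_mul, abs_of_nonneg (by positivity : 0 ≤ h * A i j)]
    rw [e1, e2]
    calc _ ≤ |x u i - (1 + h * A i i) * x t i| := abs_abs_sub_abs_le_abs_sub _ _
      _ = |h * A i j * x t j +
          (x u i - x t i - h * (A i i * x t i + A i j * x t j))| := by congr 1; ring
      _ ≤ _ := (abs_add_le _ _).trans (by gcongr)
  obtain ⟨b, hb, hb'⟩ := key 0 1 (by decide)
  obtain ⟨c, hc, hc'⟩ := key 1 0 (by decide)
  refine ⟨!![A 0 0, b; c, A 1 1], ⟨A, hA, fun i => ?_, fun i j hij => ?_⟩, ?_⟩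
  · fin_cases i <;> simp
  · fin_cases i <;> fin_cases j <;> simp at hij ⊢ <;> assumption
  · rw [pi_norm_le_iff_of_nonneg he]
    intro i
    fin_cases i
    · simp [dotProduct, Fin.sum_univ_two]
      refine le_trans (le_of_eq ?_) hb'
      congr 1
      ring
    · simp [dotProduct, Fin.sum_univ_two]
      refine le_trans (le_of_eq ?_) hc'
      congr 1
      ring

/-! ### The Lyapunov function -/

/-- A strict separation of the velocities `B (1 - θ, θ)`, `B ∈ 𝒟`, from the ray of radial
velocities with rate at least `σ`. -/
theorem exists_slope {𝒟 : Set (Matrix (Fin 2) (Fin 2) ℝ)} (hcomp : IsCompact 𝒟)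
    (hconv : Convex ℝ 𝒟) {σ θ : ℝ}
    (h : ∀ B ∈ 𝒟, ∀ μ, σ ≤ μ → B.mulVec ![1 - θ, θ] ≠ μ • ![1 - θ, θ]) :
    ∃ b : ℝ, ∀ B ∈ 𝒟, B.mulVec ![1 - θ, θ] 0 + B.mulVec ![1 - θ, θ] 1 +
      b * (B.mulVec ![1 - θ, θ] 1 - θ * (B.mulVec ![1 - θ, θ] 0 + B.mulVec ![1 - θ, θ] 1)) < σ := by
  -- The coordinates are the rates of change of z 0 + z 1 and of the direction θ; the velocity is
  -- radial exactly when the second vanishes.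
  let F : Matrix (Fin 2) (Fin 2) ℝ →ₗ[ℝ] ℝ × ℝ :=
    { toFun := fun B => (B.mulVec ![1 - θ, θ] 0 + B.mulVec ![1 - θ, θ] 1,
        B.mulVec ![1 - θ, θ] 1 - θ * (B.mulVec ![1 - θ, θ] 0 + B.mulVec ![1 - θ, θ] 1))
      map_add' := fun A B => by
        simp only [Matrix.add_mulVec, Pi.add_apply, Prod.mk_add_mk, Prod.mk.injEq]
        constructor <;> ring
      map_smul' := fun c A => by
        simp only [Matrix.smul_mulVec, Pi.smul_apply, smul_eq_mul, RingHom.id_apply,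
          Prod.smul_mk, Prod.mk.injEq]
        constructor <;> ring }
  have hF : ∀ B, F B = (B.mulVec ![1 - θ, θ] 0 + B.mulVec ![1 - θ, θ] 1,
        B.mulVec ![1 - θ, θ] 1 - θ * (B.mulVec ![1 - θ, θ] 0 + B.mulVec ![1 - θ, θ] 1)) :=
    fun B => rfl
  have hFc : Continuous F := F.continuous_of_finiteDimensional
  have hK : IsCompact (F '' 𝒟) := hcomp.image hFc
  have hdisj : Disjoint (F '' 𝒟) (Ici σ ×ˢ {0}) := by
    rw [Set.disjoint_left]
    rintro _ ⟨B, hB, rfl⟩ ⟨h1, h2⟩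
    rw [hF] at h1 h2
    simp only [mem_Ici, mem_singleton_iff] at h1 h2
    refine h B hB _ h1 ?_
    ext i
    fin_cases i <;> simp only [Fin.zero_eta, Fin.mk_one, Pi.smul_apply, smul_eq_mul,
      Matrix.cons_val_zero, Matrix.cons_val_one] <;> linarith
  obtain ⟨f, u, v, hfu, huv, hfv⟩ := geometric_hahn_banach_compact_closed
    (hconv.linear_image F) hK ((convex_Ici σ).prod (convex_singleton 0))
    (isClosed_Ici.prod isClosed_singleton) hdisj
  have hf : ∀ p q : ℝ, f (p, q) = f (1, 0) * p + f (0, 1) * q := by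
    intro p q
    have : (p, q) = p • ((1 : ℝ), (0 : ℝ)) + q • ((0 : ℝ), (1 : ℝ)) := by simp
    rw [this, map_add, map_smul, map_smul]
    simp only [smul_eq_mul]
    ring
  set a := f (1, 0)
  set c := f (0, 1)
  have hray : ∀ p, σ ≤ p → v < a * p := by
    intro p hp
    have := hfv (p, 0) ⟨hp, rfl⟩
    rwa [hf, mul_zero, add_zero] at this
  have ha : 0 ≤ a := by
    by_contra! hneg
    have h1 := hray (σ + |v - a * σ| / (-a)) (le_add_of_nonneg_right
      (div_nonneg (abs_nonneg _) (by linarith)))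
    have e : a * (|v - a * σ| / (-a)) = -|v - a * σ| := by
      have := hneg.ne
      field_simp
    rw [mul_add, e] at h1
    have h2 := hray σ le_rfl
    have := neg_abs_le (v - a * σ)
    have := abs_nonneg (v - a * σ)
    have := abs_of_neg (show v - a * σ < 0 by linarith)
    linarith
  obtain ⟨M, hM⟩ := hK.exists_bound_of_continuousOn (f := fun p : ℝ × ℝ => p.1 - σ) (by fun_prop)
  have hσ := hray σ le_rfl
  -- The coefficient a may be 0. Adding η, small relative to the separation gap m, keeps the strict
  -- inequality on the compact image and permits division by a + η.
  set m := a * σ - u with hm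
  have hmpos : 0 < m := by linarith
  set η := m / (|M| + 1) with hη
  have hηpos : 0 < η := by positivity
  refine ⟨c / (a + η), fun B hB => ?_⟩
  have h1 := hfu _ (mem_image_of_mem F hB)
  have h2 := hM _ (mem_image_of_mem F hB)
  rw [hF] at h1 h2
  rw [hf] at h1
  simp only [Real.norm_eq_abs] at h2
  set N := B.mulVec ![1 - θ, θ] 0 + B.mulVec ![1 - θ, θ] 1
  set R := B.mulVec ![1 - θ, θ] 1 - θ * N
  have h3 : N - σ ≤ |M| := (le_abs_self _).trans (h2.trans (le_abs_self _))
  have h4 : η * (N - σ) < m := by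
    calc η * (N - σ) ≤ η * |M| := mul_le_mul_of_nonneg_left h3 hηpos.le
      _ < η * (|M| + 1) := by nlinarith
      _ = m := by rw [hη]; field_simp
  have hpos : 0 < a + η := by linarith
  have e : (a + η) * (N + c / (a + η) * R - σ) = (a + η) * (N - σ) + c * R := by
    field_simp
    ring
  have : (a + η) * (N + c / (a + η) * R - σ) < 0 := by rw [e]; linarith
  have := neg_of_mul_neg_right this hpos.le
  linarith

/-- The condition on a slope is affine in it, so the admissible slopes at θ form a convex set, and
by compactness of 𝒟 a slope admissible at θ is admissible nearby. A partition of unity then glues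
local constants. -/
theorem exists_continuous_slope {𝒟 : Set (Matrix (Fin 2) (Fin 2) ℝ)} (hcomp : IsCompact 𝒟)
    (hconv : Convex ℝ 𝒟) {σ : ℝ}
    (h : ∀ B ∈ 𝒟, ∀ v : Fin 2 → ℝ, 0 ≤ v → v ≠ 0 → ∀ μ, σ ≤ μ → B.mulVec v ≠ μ • v) :
    ∃ b : ℝ → ℝ, Continuous b ∧ ∀ θ ∈ Icc (0 : ℝ) 1, ∀ B ∈ 𝒟,
      B.mulVec ![1 - θ, θ] 0 + B.mulVec ![1 - θ, θ] 1 + b θ *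
        (B.mulVec ![1 - θ, θ] 1 - θ * (B.mulVec ![1 - θ, θ] 0 + B.mulVec ![1 - θ, θ] 1)) < σ := by
  let P : ℝ → ℝ → Matrix (Fin 2) (Fin 2) ℝ → ℝ := fun θ b B =>
    B.mulVec ![1 - θ, θ] 0 + B.mulVec ![1 - θ, θ] 1 + b *
        (B.mulVec ![1 - θ, θ] 1 - θ * (B.mulVec ![1 - θ, θ] 0 + B.mulVec ![1 - θ, θ] 1))
  let T : ℝ → Set ℝ := fun θ => {b | θ ∈ Icc (0 : ℝ) 1 → ∀ B ∈ 𝒟, P θ b B < σ}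
  have hT : ∀ θ, Convex ℝ (T θ) := by
    intro θ b hb b' hb' p q hp hq hpq hθ B hB
    have h1 : P θ b B < σ := hb hθ B hB
    have h2 : P θ b' B < σ := hb' hθ B hB
    have e : P θ (p • b + q • b') B = p * P θ b B + q * P θ b' B := by
      obtain rfl : q = 1 - p := by linarith
      simp only [P, smul_eq_mul]
      ring
    rw [e]
    obtain rfl : q = 1 - p := by linarith
    rcases hp.eq_or_lt with rfl | hp
    · linarith
    · nlinarith
  obtain ⟨g, hg⟩ := exists_continuous_forall_mem_convex_of_local_const hT fun θ => by
    by_cases hθ : θ ∈ Icc (0 : ℝ) 1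
    · obtain ⟨b, hb⟩ := exists_slope (θ := θ) hcomp hconv (σ := σ) fun B hB μ hμ => by
        refine h B hB _ ?_ ?_ μ hμ
        · intro i
          fin_cases i
          · simpa using hθ.2
          · simpa using hθ.1
        · intro h0
          have h1 := congrFun h0 0
          have h2 := congrFun h0 1
          simp at h1 h2
          linarith
      refine ⟨b, ?_⟩
      have hc : Continuous fun p : ℝ × Matrix (Fin 2) (Fin 2) ℝ => P p.1 b p.2 := by
        simp only [P, Matrix.mulVec, dotProduct, Fin.sum_univ_two, Matrix.cons_val_zero,
          Matrix.cons_val_one]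
        fun_prop
      have := hcomp.eventually_forall_of_forall_eventually (x₀ := θ)
        (P := fun θ B => P θ b B < σ) fun B hB =>
          (hc.tendsto (θ, B)).eventually (gt_mem_nhds (hb B hB))
      filter_upwards [this] with θ' hθ' _ using hθ'
    · refine ⟨0, ?_⟩
      filter_upwards [isClosed_Icc.isOpen_compl.mem_nhds hθ] with θ' hθ' h0
      exact absurd h0 hθ'
  exact ⟨g, g.continuous, fun θ hθ B hB => hg θ hθ B hB⟩

/-- The positively homogeneous function on the plane, `exp (∫ b)` on the line `z₀ + z₁ = 1`. -/
def homogeneousLyapunov (b : ℝ → ℝ) (z : Fin 2 → ℝ) : ℝ :=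
  (z 0 + z 1) * Real.exp (∫ s in (0 : ℝ)..(z 1 / (z 0 + z 1)), b s)

theorem add_pos_of_nonneg_of_ne_zero {z : Fin 2 → ℝ} (hz : 0 ≤ z) (hz0 : z ≠ 0) :
    0 < z 0 + z 1 := by
  have h0 : 0 ≤ z 0 := hz 0
  have h1 : 0 ≤ z 1 := hz 1
  refine (add_nonneg h0 h1).lt_of_ne fun h => hz0 ?_
  ext i
  fin_cases i <;> simp <;> linarith

/-- The second factor of the derivative is the expression bounded by σ in `exists_continuous_slope`.
-/
theorem hasFDerivAt_homogeneousLyapunov {b : ℝ → ℝ} (hb : Continuous b) {z : Fin 2 → ℝ}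
    (hz : z 0 + z 1 ≠ 0) :
    ∃ φ : (Fin 2 → ℝ) →L[ℝ] ℝ, HasFDerivAt (homogeneousLyapunov b) φ z ∧
      ∀ u, φ u = Real.exp (∫ s in (0 : ℝ)..(z 1 / (z 0 + z 1)), b s) *
        (u 0 + u 1 + b (z 1 / (z 0 + z 1)) * (u 1 - z 1 / (z 0 + z 1) * (u 0 + u 1))) := by
  have h0 : HasFDerivAt (fun z : Fin 2 → ℝ => z 0)
    (ContinuousLinearMap.proj (R := ℝ) (φ := fun _ : Fin 2 => ℝ) 0) z := hasFDerivAt_apply 0 z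
  have h1 : HasFDerivAt (fun z : Fin 2 → ℝ => z 1)
    (ContinuousLinearMap.proj (R := ℝ) (φ := fun _ : Fin 2 => ℝ) 1) z := hasFDerivAt_apply 1 z
  have hN := h0.add h1
  have hinv := (hasDerivAt_inv hz).comp_hasFDerivAt z hN
  have hq := h1.mul hinv
  have hG : HasDerivAt (fun r => ∫ s in (0 : ℝ)..r, b s) (b (z 1 * (z 0 + z 1)⁻¹))
      (z 1 * (z 0 + z 1)⁻¹) :=
    intervalIntegral.integral_hasDerivAt_right (hb.intervalIntegrable _ _)
      hb.stronglyMeasurable.stronglyMeasurableAtFilter hb.continuousAt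
  have hV := hN.mul ((hG.comp_hasFDerivAt z hq).exp)
  refine ⟨_, hV, fun u => ?_⟩
  simp only [Function.comp, _root_.add_apply, _root_.smul_apply,
    ContinuousLinearMap.proj_apply, smul_eq_mul, div_eq_mul_inv, Pi.add_apply, Pi.mul_apply]
  field_simp
  ring

theorem homogeneousLyapunov_bounds {b : ℝ → ℝ} (hb : Continuous b) :
    ∃ c C : ℝ, 0 < c ∧ 0 < C ∧ ∀ z : Fin 2 → ℝ, 0 ≤ z →
      c * (z 0 + z 1) ≤ homogeneousLyapunov b z ∧
        homogeneousLyapunov b z ≤ C * (z 0 + z 1) := by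
  have hG : Continuous fun r => ∫ s in (0 : ℝ)..r, b s :=
    intervalIntegral.continuous_primitive (fun _ _ => hb.intervalIntegrable _ _) 0
  obtain ⟨M, hM⟩ := (isCompact_Icc (a := (0 : ℝ)) (b := 1)).exists_bound_of_continuousOn
    hG.continuousOn
  refine ⟨Real.exp (-M), Real.exp M, Real.exp_pos _, Real.exp_pos _, fun z hz => ?_⟩
  have h0 : 0 ≤ z 0 := hz 0
  have h1 : 0 ≤ z 1 := hz 1
  have hs : z 1 / (z 0 + z 1) ∈ Icc (0 : ℝ) 1 :=
    ⟨by positivity, div_le_one_of_le₀ (by linarith) (by linarith)⟩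
  have := abs_le.1 (hM _ hs)
  rw [homogeneousLyapunov, mul_comm (z 0 + z 1)]
  constructor
  · gcongr
    exact this.1
  · gcongr
    exact this.2

/-- At the origin, where the direction is undefined, the two linear bounds squeeze the function to
0. -/
theorem continuousOn_homogeneousLyapunov {b : ℝ → ℝ} (hb : Continuous b) :
    ContinuousOn (homogeneousLyapunov b) (Ici 0) := by
  intro z hz
  by_cases hz0 : z = 0
  · subst hz0
    obtain ⟨c, C, hc, hC, hcC⟩ := homogeneousLyapunov_bounds hb
    have e : homogeneousLyapunov b 0 = 0 := by simp [homogeneousLyapunov]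
    rw [ContinuousWithinAt, e]
    have hlim : ∀ k : ℝ, Tendsto (fun z : Fin 2 → ℝ => k * (z 0 + z 1)) (𝓝[Ici 0] 0) (𝓝 0) := by
      intro k
      have : Continuous fun z : Fin 2 → ℝ => k * (z 0 + z 1) := by fun_prop
      simpa using (this.tendsto 0).mono_left (nhdsWithin_le_nhds (s := Ici (0 : Fin 2 → ℝ)))
    refine tendsto_of_tendsto_of_tendsto_of_le_of_le' (hlim c) (hlim C) ?_ ?_ <;>
      filter_upwards [self_mem_nhdsWithin] with z hz
    · exact (hcC z hz).1
    · exact (hcC z hz).2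
  · obtain ⟨φ, hφ, -⟩ :=
      hasFDerivAt_homogeneousLyapunov hb (add_pos_of_nonneg_of_ne_zero hz hz0).ne'
    exact hφ.continuousAt.continuousWithinAt

/-! ### Upper bound for the growth rate -/

/-- Exponential bound for trajectories by means of a positively homogeneous Lyapunov function of
the vector of absolute values. -/
theorem SolvesODE.exists_exp_bound {𝒞 : Set (Matrix (Fin 2) (Fin 2) ℝ)}
    (hcomp : IsCompact 𝒞) (hconv : Convex ℝ 𝒞) (hM : ∀ A ∈ 𝒞, IsMetzler A) {σ : ℝ}
    (hσ : ∀ A ∈ 𝒞, perronRoot A < σ) {L : ℝ → Matrix (Fin 2) (Fin 2) ℝ}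
    (hL : IsSwitchingLaw 𝒞 L) {x : ℝ → Fin 2 → ℝ} (hx : SolvesODE L x) :
    ∃ C : ℝ, ∀ t, 0 ≤ t → ‖x t‖ ≤ C * Real.exp (σ * t) := by
  set 𝒟 := offDiagDominated 𝒞 with h𝒟
  have hDcomp : IsCompact 𝒟 := isCompact_offDiagDominated hcomp hM
  have hDconv : Convex ℝ 𝒟 := convex_offDiagDominated hconv
  obtain ⟨K, hK0, hK⟩ := hDcomp.exists_entries_bound
  obtain ⟨b, hb, hbσ⟩ := exists_continuous_slope hDcomp hDconv (σ := σ) (by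
    rintro B ⟨A, hA, hd, ho⟩ v hv hv0 μ hμ he
    refine absurd ((hM A hA).le_perronRoot hv hv0 (s := μ) ?_) (not_le.2 ((hσ A hA).trans_le hμ))
    rw [← he]
    refine Matrix.mulVec_le_mulVec_of_entries ?_ hv
    intro i j
    by_cases hij : i = j
    · subst hij; exact (hd i).le
    · exact (le_abs_self _).trans (ho i j hij))
  set V := homogeneousLyapunov b with hV
  obtain ⟨c, C, hc, hC, hcC⟩ := homogeneousLyapunov_bounds hb
  have hzc : ContinuousOn (fun t => |x t|) (Ici 0) :=
    continuousOn_pi.2 fun i => ((continuous_apply i).comp_continuousOn hx.continuousOn).abs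
  have hVc : ContinuousOn (fun t => V |x t|) (Ici 0) :=
    (continuousOn_homogeneousLyapunov hb).comp hzc fun t _ => abs_nonneg (x t)
  have hslope : ∀ t, 0 ≤ t → ∃ m, (V |x t| ≠ 0 → m < σ * V |x t|) ∧
      ∀ r, m < r → ∃ᶠ u in 𝓝[>] t, slope (fun t => V |x t|) t u < r := by
    intro t ht
    have hinc := fun {η : ℝ} (hη : 0 < η) => hx.eventually_abs_increment hcomp hconv hM hL ht hη
    by_cases hz0 : |x t| = 0
    · have hV0 : V |x t| = 0 := by rw [hz0]; simp [hV, homogeneousLyapunov]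
      -- At the origin the increment of |x| is o(u - t) and V grows at most linearly, so the right
      -- derivative is 0.
      refine ⟨0, fun h => absurd hV0 h, fun r hr => Eventually.frequently ?_⟩
      have hη : 0 < r / (4 * C) := by positivity
      filter_upwards [hinc hη, self_mem_nhdsWithin] with u ⟨B, hB, hu⟩ htu
      have htu : 0 < u - t := sub_pos.2 htu
      rw [hz0, Matrix.mulVec_zero, smul_zero, sub_zero, sub_zero] at hu
      rw [slope_def_field, hV0, sub_zero, div_lt_iff₀ htu]
      have h0 := (norm_le_pi_norm |x u| 0).trans hu
      have h1 := (norm_le_pi_norm |x u| 1).trans hu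
      have h2 := (le_abs_self _).trans h0
      have h3 := (le_abs_self _).trans h1
      calc V |x u| ≤ C * (|x u| 0 + |x u| 1) := (hcC _ (abs_nonneg _)).2
        _ ≤ C * (r / (4 * C) * (u - t) + r / (4 * C) * (u - t)) := by gcongr
        _ = r * (u - t) / 2 := by field_simp; ring
        _ < r * (u - t) := by nlinarith [mul_pos hr htu]
    · set z := |x t| with hz
      have hznn : 0 ≤ z := abs_nonneg _
      have hN := add_pos_of_nonneg_of_ne_zero hznn hz0
      obtain ⟨φ, hφ, hφv⟩ := hasFDerivAt_homogeneousLyapunov hb hN.ne'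
      have hφB : ∀ B ∈ 𝒟, φ (B.mulVec z) < σ * V z := by
        intro B hB
        set θ := z 1 / (z 0 + z 1) with hθ
        have hzθ : z = (z 0 + z 1) • ![1 - θ, θ] := by
          ext i
          fin_cases i
          · simp [hθ]; field_simp; ring
          · simp [hθ]; field_simp
        have hθm : θ ∈ Icc (0 : ℝ) 1 :=
          ⟨div_nonneg (hznn 1) hN.le, div_le_one_of_le₀ (by
            have : 0 ≤ z 0 := hznn 0
            linarith) hN.le⟩
        have hlt := hbσ θ hθm B hB
        have e : B.mulVec z = (z 0 + z 1) • B.mulVec ![1 - θ, θ] := by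
          conv_lhs => rw [hzθ]
          rw [Matrix.mulVec_smul]
        rw [e, map_smul, hφv, smul_eq_mul]
        have eV : V z = (z 0 + z 1) * Real.exp (∫ s in (0 : ℝ)..θ, b s) := rfl
        rw [eV, ← mul_assoc, mul_comm σ]
        exact mul_lt_mul_of_pos_left hlt (mul_pos hN (Real.exp_pos _))
      have hDne : 𝒟.Nonempty := by
        obtain ⟨u, B, hB, -⟩ := (hinc one_pos).exists
        exact ⟨B, hB⟩
      -- The matrix B in the increment depends on u, so the slope is controlled by the maximum of
      -- φ(Bz) over 𝒟, which is still below σ V(z).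
      obtain ⟨B₀, hB₀, hmax⟩ := hDcomp.exists_isMaxOn hDne
        (f := fun B => φ (B.mulVec z))
        (φ.continuous.comp (Continuous.matrix_mulVec continuous_id continuous_const)).continuousOn
      refine ⟨φ (B₀.mulVec z), fun _ => hφB _ hB₀, fun r hr => Eventually.frequently ?_⟩
      -- The error per unit time is at most ε‖φ‖ from the increment plus ε(2K‖z‖ + 1) from
      -- linearising V.
      set Q := ‖φ‖ + (2 * K * ‖z‖ + 1) + 1 with hQ
      have hQpos : 0 < Q := by positivity
      set ε := min 1 ((r - φ (B₀.mulVec z)) / (2 * Q)) with hε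
      have hεpos : 0 < ε := lt_min one_pos (div_pos (sub_pos.2 hr) (by positivity))
      have hε1 : ε ≤ 1 := min_le_left _ _
      have hεQ : ε * Q < r - φ (B₀.mulVec z) := by
        have : ε ≤ (r - φ (B₀.mulVec z)) / (2 * Q) := min_le_right _ _
        rw [le_div_iff₀ (by positivity)] at this
        nlinarith [sub_pos.2 hr]
      have hzt : Tendsto (fun u => |x u|) (𝓝[>] t) (𝓝 z) :=
        ((hzc t ht).mono (Ioi_subset_Ici ht)).tendsto
      have hlin := hzt.eventually ((hasFDerivAt_iff_isLittleO.1 hφ).def hεpos)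
      filter_upwards [hinc hεpos, self_mem_nhdsWithin, hlin] with u ⟨B, hB, hu⟩ htu hlin
      have htu : 0 < u - t := sub_pos.2 htu
      rw [slope_def_field, div_lt_iff₀ htu]
      set e := |x u| - z - (u - t) • B.mulVec z with he
      have hsplit : |x u| - z = (u - t) • B.mulVec z + e := by rw [he]; abel
      have hBz : ‖B.mulVec z‖ ≤ 2 * K * ‖z‖ := by
        simpa using Matrix.norm_mulVec_le_of_entries hK0 (hK B hB) z
      have hnorm : ‖|x u| - z‖ ≤ (u - t) * (2 * K * ‖z‖ + 1) := by
        rw [hsplit]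
        refine (norm_add_le _ _).trans ?_
        rw [norm_smul, Real.norm_eq_abs, abs_of_pos htu]
        nlinarith
      have h1 : V |x u| - V z - φ (|x u| - z) ≤ ε * ‖|x u| - z‖ := (le_abs_self _).trans hlin
      have h2 : φ (|x u| - z) ≤ (u - t) * φ (B₀.mulVec z) + ‖φ‖ * (ε * (u - t)) := by
        rw [hsplit, map_add, map_smul, smul_eq_mul]
        refine add_le_add (mul_le_mul_of_nonneg_left (hmax hB) htu.le) ?_
        exact (le_abs_self _).trans ((φ.le_opNorm e).trans (by gcongr))
      have h3 : ε * ‖|x u| - z‖ ≤ ε * ((u - t) * (2 * K * ‖z‖ + 1)) := by gcongr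
      have h4 : ε * Q * (u - t) < (r - φ (B₀.mulVec z)) * (u - t) := by gcongr
      have h5 : 0 < ε * (u - t) := by positivity
      rw [hQ] at h4
      nlinarith
  choose! m hm hmr using hslope
  have hV0 : 0 ≤ V |x 0| := (mul_nonneg hc.le
    (add_nonneg (abs_nonneg (x 0 0)) (abs_nonneg (x 0 1)))).trans (hcC _ (abs_nonneg (x 0))).1
  -- The +1 keeps the comparison function positive, so V ≠ 0 wherever they touch and the strict
  -- bound on the slope applies.
  have hbound : ∀ t, 0 ≤ t → V |x t| ≤ (V |x 0| + 1) * Real.exp (σ * t) := by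
    intro t ht
    have hB' : ∀ s, HasDerivAt (fun s => (V |x 0| + 1) * Real.exp (σ * s))
        (σ * ((V |x 0| + 1) * Real.exp (σ * s))) s := by
      intro s
      refine ((((hasDerivAt_id s).const_mul σ).exp).const_mul (V |x 0| + 1)).congr_deriv ?_
      simp only [id]
      ring
    refine image_le_of_liminf_slope_right_lt_deriv_boundary (f := fun t => V |x t|) (f' := m)
      (hVc.mono Icc_subset_Ici_self) (fun s hs => hmr s hs.1) (by simp) hB'
      (fun s hs he => ?_) ⟨ht, le_rfl⟩
    rw [← he]
    refine hm s hs.1 ?_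
    rw [he]
    positivity
  refine ⟨(V |x 0| + 1) / c, fun t ht => ?_⟩
  have h1 := (hcC _ (abs_nonneg (x t))).1.trans (hbound t ht)
  rw [div_mul_eq_mul_div, le_div_iff₀ hc, mul_comm]
  refine le_trans (mul_le_mul_of_nonneg_left ?_ hc.le) h1
  have a0 := abs_nonneg (x t 0)
  have a1 := abs_nonneg (x t 1)
  have e0 : |x t| 0 = |x t 0| := rfl
  have e1 : |x t| 1 = |x t 1| := rfl
  rw [e0, e1]
  refine (pi_norm_le_iff_of_nonneg (by positivity)).2 fun i => ?_
  fin_cases i <;> simp only [Fin.zero_eta, Fin.mk_one, Real.norm_eq_abs] <;> linarith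

/-! ### The Lyapunov exponent as a maximal Perron root, and the conclusions -/

theorem IsPositiveSystem.exists_exp_bound {𝒜 : Set (Matrix (Fin 2) (Fin 2) ℝ)}
    (hpos : IsPositiveSystem 𝒜) (hcompact : IsCompact 𝒜) {s : ℝ}
    (hs : ∀ A ∈ convexHull ℝ 𝒜, perronRoot A < s) (x : ℝ → Fin 2 → ℝ) (hx : IsTrajectory 𝒜 x) :
    ∃ C : ℝ, ∀ t, 0 ≤ t → ‖x t‖ ≤ C * Real.exp (s * t) := by
  obtain ⟨L, hL, hx⟩ := hx
  exact hx.exists_exp_bound (isCompact_convexHull_of_isCompact hcompact) (convex_convexHull ℝ 𝒜)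
    (fun A hA => hpos.isMetzler_of_mem_convexHull hA) hs
    ⟨hL.measurable, fun t ht => subset_convexHull ℝ 𝒜 (hL.mem t ht)⟩

theorem exists_max_perronRoot {𝒜 : Set (Matrix (Fin 2) (Fin 2) ℝ)}
    (hne : 𝒜.Nonempty) (hcompact : IsCompact 𝒜) :
    ∃ A ∈ convexHull ℝ 𝒜, ∀ B ∈ convexHull ℝ 𝒜, perronRoot B ≤ perronRoot A :=
  (isCompact_convexHull_of_isCompact hcompact).exists_isMaxOn (convexHull_nonempty_iff.2 hne)
    continuous_perronRoot.continuousOn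

/-- The Lyapunov exponent of a planar positive system is the maximal Perron root over the convex
hull. -/
theorem IsPositiveSystem.lyapunovExponent_eq {𝒜 : Set (Matrix (Fin 2) (Fin 2) ℝ)}
    (hpos : IsPositiveSystem 𝒜) (hcompact : IsCompact 𝒜) {A : Matrix (Fin 2) (Fin 2) ℝ}
    (hA : A ∈ convexHull ℝ 𝒜) (hmax : ∀ B ∈ convexHull ℝ 𝒜, perronRoot B ≤ perronRoot A) :
    lyapunovExponent 𝒜 = perronRoot A := by
  have hlow : ∀ s ∈ {σ : ℝ | ∀ x, IsTrajectory 𝒜 x →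
      ∃ C : ℝ, ∀ t, 0 ≤ t → ‖x t‖ ≤ C * Real.exp (σ * t)}, perronRoot A ≤ s :=
    fun s hs => hpos.perronRoot_le hcompact hs hA
  have hup : ∀ s, perronRoot A < s → s ∈ {σ : ℝ | ∀ x, IsTrajectory 𝒜 x →
      ∃ C : ℝ, ∀ t, 0 ≤ t → ‖x t‖ ≤ C * Real.exp (σ * t)} :=
    fun s hs => hpos.exists_exp_bound hcompact fun B hB => (hmax B hB).trans_lt hs
  refine le_antisymm ?_ (le_csInf ⟨_, hup _ (lt_add_one _)⟩ hlow)
  exact le_of_forall_gt_imp_ge_of_dense fun s hs => csInf_le ⟨_, hlow⟩ (hup s hs)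

/-- If the stationary trajectories of a Metzler matrix tend to zero, its Perron root is negative. -/
theorem IsMetzler.perronRoot_neg {A : Matrix (Fin 2) (Fin 2) ℝ} (hA : IsMetzler A)
    (h : ∀ x, IsTrajectory {A} x → Tendsto x atTop (𝓝 0)) : perronRoot A < 0 := by
  obtain ⟨v, -, hv0, hv⟩ := hA.exists_eigenvector
  set l := perronRoot A
  have hd : ∀ t, HasDerivAt (fun t : ℝ => Real.exp (l * t) • v)
      (A.mulVec (Real.exp (l * t) • v)) t := by
    intro t
    have h1 : HasDerivAt (fun t : ℝ => Real.exp (l * t)) (Real.exp (l * t) * l) t := by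
      simpa using ((hasDerivAt_id t).const_mul l).exp
    refine (h1.smul_const v).congr_deriv ?_
    rw [Matrix.mulVec_smul, hv, smul_smul]
  have hc : Continuous fun t : ℝ => Real.exp (l * t) • v := by fun_prop
  have hi : ∀ a b, IntervalIntegrable (fun t => A.mulVec (Real.exp (l * t) • v)) volume a b :=
    fun a b => (Continuous.matrix_mulVec continuous_const hc).intervalIntegrable a b
  have ht := h (fun t => Real.exp (l * t) • v) ⟨fun _ => A,
    ⟨fun _ _ => measurable_const, fun _ _ => rfl⟩, hc.continuousOn, fun t _ => hi 0 t,
    fun t _ => by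
      rw [intervalIntegral.integral_eq_sub_of_hasDerivAt (fun s _ => hd s) (hi 0 t)]
      abel⟩
  by_contra! hl
  obtain ⟨i, hvi⟩ := Function.ne_iff.1 hv0
  have hlim := ((tendsto_pi_nhds.1 ht) i).abs
  rw [Pi.zero_apply, abs_zero] at hlim
  refine absurd (ge_of_tendsto hlim ?_) (not_le.2 (abs_pos.2 hvi))
  filter_upwards [eventually_ge_atTop 0] with t ht
  rw [Pi.smul_apply, smul_eq_mul, abs_mul, Real.abs_exp]
  exact le_mul_of_one_le_left (abs_nonneg _) (Real.one_le_exp (mul_nonneg hl ht))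

end

theorem corollaryc20 (𝒜 : Set (Matrix (Fin 2) (Fin 2) ℝ)) (hne : 𝒜.Nonempty)
    (hcompact : IsCompact 𝒜) (hpos : IsPositiveSystem 𝒜) :
    (lyapunovExponent 𝒜 • (1 : Matrix (Fin 2) (Fin 2) ℝ) ∉ 𝒜 → HasRealDominance 𝒜) ∧
    ((∀ x, IsStationaryTrajectory 𝒜 x → Tendsto x atTop (𝓝 0)) → IsStableSystem 𝒜) := by
  obtain ⟨A, hA, hmax⟩ := exists_max_perronRoot hne hcompact
  have hAM := hpos.isMetzler_of_mem_convexHull hA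
  have hσ := hpos.lyapunovExponent_eq hcompact hA hmax
  constructor
  · intro hn
    refine ⟨A, ⟨hA, fun he => hn ?_, hσ ▸ hAM.isGreatest_perronRoot⟩,
      fun μ hμ => hAM.complexEigenvalues_im hμ⟩
    refine hpos.smul_one_mem (fun B hB => ?_) (he ▸ hA)
    rw [hσ]
    exact hmax B (subset_convexHull ℝ 𝒜 hB)
  · intro hstat x hx
    have hneg : perronRoot A < 0 := hAM.perronRoot_neg fun y hy => hstat y ⟨A, hA, hy⟩
    -- The upper bound needs a rate strictly above all Perron roots; a negative one still forces
    -- decay.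
    obtain ⟨s, hs1, hs2⟩ := exists_between hneg
    obtain ⟨C, hC⟩ := hpos.exists_exp_bound hcompact
      (fun B hB => (hmax B hB).trans_lt hs1) x hx
    have hlim : Tendsto (fun t : ℝ => C * Real.exp (s * t)) atTop (𝓝 0) := by
      simpa using (Real.tendsto_exp_atBot.comp
        (tendsto_id.const_mul_atTop_of_neg hs2)).const_mul C
    refine squeeze_zero_norm' ?_ hlim
    filter_upwards [eventually_ge_atTop 0] with t ht using hC t ht
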